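/- Let $S$ be the symmetric simple random walk on $\mathbb{Z}$ and, for $0<\alpha<1$, let $\tau=(\tau_n)_{n\ge 0}$ be a random walk on $\{0,1,2,\dots\}$ with $\tau_0=0$, independent of $S$, whose i.i.d. increments have generating function $\mathbb{E}\,z^{\tau_1}=1-(1-z)^{\alpha/2}$, that is, $\mathbb{P}(\tau_1=k)=(-1)^{k+1}\binom{\alpha/2}{k}$ for $k\ge 1$. The $\alpha$-stable random walk is $S_\alpha(n)=S(\tau_n)$, $n\ge 0$; its transition operator is $I-(I-P)^{\alpha/2}$, where $P$ is the transition operator of $S$. A set $B\subset\mathbb{Z}$ is called $S_\alpha$-massive if, for every starting point $x\in\mathbb{Z}$, the walk $S_\alpha$ started at $x$ hits $B$ with probability $1$. For $\beta\ge 1$ let $\mathcal{P}_\beta$ be the set of Piatetski-Shapiro primes, i.e. of the primes of the form $[n^\beta]$ with $n\ge 1$ an integer, where $[\cdot]$ denotes the integer part. Let $\alpha\in\left(0,\frac{391}{2817}\right)$. Then there exists $\beta\in\left[1,\frac{2817}{2426}\right)$ with $\alpha+\frac1\beta<1$, and for every such $\beta$ $$\sum_{p\in\mathcal{P}_\beta}p^{\alpha-1}<\infty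 ,$$ and the set $\mathcal{P}_\beta$ is not $S_\alpha$-massive. -/

import Mathlib

noncomputable section

/-- The law of one step of the symmetric simple random walk on `ℤ`: uniform on `{-1, 1}`. -/
def simpleStep : PMF ℤ := PMF.uniformOfFinset {-1, 1} (by simp)

/-- The weight `(-1)^(k+1) * binom(α/2, k)` for `k ≥ 1` (and `0` for `k = 0`), i.e. the coefficient
of `z^k` in the power series of `1 - (1 - z)^(α/2)`. -/
def stableWeight (α : ℝ) (k : ℕ) : ℝ :=
  if k = 0 then 0 else (-1) ^ (k + 1) * Ring.choose (α / 2) k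

/-- Auxiliary: the tail sums `∑_{j > k} stableWeight α j`. -/
def stableTail (α : ℝ) (k : ℕ) : ℝ := (-1) ^ k * Ring.choose (α / 2 - 1) k

theorem stableWeight_succ (α : ℝ) (k : ℕ) :
    stableWeight α (k + 1) = stableTail α k - stableTail α (k + 1) := by
  have h := Ring.choose_succ_succ (α / 2 - 1) k
  simp only [sub_add_cancel] at h
  simp only [stableWeight, stableTail, Nat.succ_ne_zero, if_false, h]
  ring

theorem stableTail_succ (α : ℝ) (k : ℕ) :
    stableTail α (k + 1) = stableTail α k * (1 - α / 2 / (k + 1)) := by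
  have hk : (k : ℝ) + 1 ≠ 0 := by positivity
  have hf : (k.factorial : ℝ) ≠ 0 := by positivity
  simp only [stableTail, Ring.choose_eq_smul, descPochhammer_succ_right, Nat.factorial_succ,
    smul_eq_mul, Polynomial.smeval_mul, Polynomial.smeval_sub, Polynomial.smeval_X,
    Polynomial.smeval_natCast]
  push_cast
  simp
  field_simp
  ring

theorem stableTail_pos {α : ℝ} (hα : α ∈ Set.Ioo (0 : ℝ) 2) (k : ℕ) : 0 < stableTail α k := by
  induction k with
  | zero => simp [stableTail]
  | succ k ih =>
    rw [stableTail_succ]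
    have hk : (0 : ℝ) < k + 1 := by positivity
    have : α / 2 / (k + 1) < 1 := by
      rw [div_lt_one hk]
      have := hα.2
      have : (0 : ℝ) ≤ k := by positivity
      linarith
    exact mul_pos ih (by linarith)

theorem stableWeight_nonneg {α : ℝ} (hα : α ∈ Set.Ioo (0 : ℝ) 2) (k : ℕ) :
    0 ≤ stableWeight α k := by
  cases k with
  | zero => simp [stableWeight]
  | succ k =>
    rw [stableWeight_succ, stableTail_succ]
    have h1 := stableTail_pos hα k
    have h2 : 0 < α / 2 / ((k : ℝ) + 1) := by
      have := hα.1
      positivity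
    nlinarith

theorem stableTail_tendsto {α : ℝ} (hα : α ∈ Set.Ioo (0 : ℝ) 2) :
    Filter.Tendsto (stableTail α) Filter.atTop (nhds 0) := by
  have hle : ∀ k, stableTail α k ≤
      Real.exp (-(α / 2 * ∑ i ∈ Finset.range k, 1 / ((i : ℝ) + 1))) := by
    intro k
    induction k with
    | zero => simp [stableTail]
    | succ k ih =>
      rw [stableTail_succ, Finset.sum_range_succ, mul_add, neg_add, Real.exp_add]
      have h1 : 1 - α / 2 / ((k : ℝ) + 1) ≤ Real.exp (-(α / 2 * (1 / ((k : ℝ) + 1)))) := by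
        have := Real.add_one_le_exp (-(α / 2 * (1 / ((k : ℝ) + 1))))
        rw [mul_one_div] at this ⊢
        linarith
      calc _ ≤ stableTail α k * Real.exp (-(α / 2 * (1 / ((k : ℝ) + 1)))) :=
            mul_le_mul_of_nonneg_left h1 (stableTail_pos hα k).le
        _ ≤ _ := mul_le_mul_of_nonneg_right ih (Real.exp_pos _).le
  refine squeeze_zero (fun k => (stableTail_pos hα k).le) hle ?_
  refine Real.tendsto_exp_neg_atTop_nhds_zero.comp ?_
  exact Real.tendsto_sum_range_one_div_nat_succ_atTop.const_mul_atTop (by linarith [hα.1])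

theorem stableWeight_hasSum {α : ℝ} (hα : α ∈ Set.Ioo (0 : ℝ) 2) :
    HasSum (fun k => ENNReal.ofReal (stableWeight α k)) 1 := by
  have h : HasSum (stableWeight α) 1 := by
    rw [hasSum_iff_tendsto_nat_of_nonneg (stableWeight_nonneg hα),
      ← Filter.tendsto_add_atTop_iff_nat 1]
    have hs : ∀ n, ∑ i ∈ Finset.range (n + 1), stableWeight α i = 1 - stableTail α n := by
      intro n
      induction n with
      | zero => simp [stableWeight, stableTail]
      | succ n ih => rw [Finset.sum_range_succ, ih, stableWeight_succ]; ring
    simp only [hs]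
    simpa using (stableTail_tendsto hα).const_sub 1
  have h2 := ENNReal.ofReal_tsum_of_nonneg (stableWeight_nonneg hα) h.summable
  rw [h.tsum_eq, ENNReal.ofReal_one] at h2
  rw [h2]
  exact ENNReal.summable.hasSum

/-- The law of one step of the discrete `α/2`-stable subordinator: the probability measure on
`{1, 2, 3, …}` with generating function `1 - (1 - z)^(α/2)`. -/
def subordinatorStep (α : ℝ) (hα : α ∈ Set.Ioo (0 : ℝ) 2) : PMF ℕ :=
  ⟨fun k => ENNReal.ofReal (stableWeight α k), stableWeight_hasSum hα⟩

/-- The sample space: the increments of the simple random walk and those of the subordinator. -/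
abbrev WalkSpace : Type := (ℕ → ℤ) × (ℕ → ℕ)

/-- The probability on the sample space: all increments are independent, those of the simple
random walk have law `simpleStep`, those of the subordinator have law `subordinatorStep α`. -/
def walkMeasure (α : ℝ) (hα : α ∈ Set.Ioo (0 : ℝ) 2) : MeasureTheory.Measure WalkSpace :=
  (MeasureTheory.Measure.infinitePi fun _ : ℕ => simpleStep.toMeasure).prod
    (MeasureTheory.Measure.infinitePi fun _ : ℕ => (subordinatorStep α hα).toMeasure)

/-- The simple random walk started at `x`, after `m` steps. -/
def simpleWalk (x : ℤ) (m : ℕ) (ω : WalkSpace) : ℤ := x + ∑ i ∈ Finset.range m, ω.1 i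

/-- The subordinator `τ_n`. -/
def subordinator (n : ℕ) (ω : WalkSpace) : ℕ := ∑ i ∈ Finset.range n, ω.2 i

/-- The `α`-stable random walk started at `x`, after `n` steps: the simple random walk at the
random time `τ_n`. The parameter `α` enters only through the measure `walkMeasure α`. -/
def stableWalk (x : ℤ) (n : ℕ) (ω : WalkSpace) : ℤ := simpleWalk x (subordinator n ω) ω

/-- The probability `p_B(x)` that the `α`-stable random walk started at `x` ever hits `B`
(time `0` included). -/
def hittingProbability (α : ℝ) (hα : α ∈ Set.Ioo (0 : ℝ) 2) (B : Set ℤ) (x : ℤ) : ENNReal :=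
  walkMeasure α hα {ω | ∃ n : ℕ, stableWalk x n ω ∈ B}

/-- `B ⊆ ℤ` is `S_α`-massive: the walk hits `B` with probability one from every starting point. -/
def IsMassive (α : ℝ) (hα : α ∈ Set.Ioo (0 : ℝ) 2) (B : Set ℤ) : Prop :=
  ∀ x : ℤ, hittingProbability α hα B x = 1

/-- The Piatetski-Shapiro primes: the primes of the form `[n^β]` with `n ≥ 1`. -/
def piatetskiShapiroPrimes (β : ℝ) : Set ℕ :=
  {p | p.Prime ∧ ∃ n : ℕ, 1 ≤ n ∧ p = ⌊(n : ℝ) ^ β⌋₊}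

end

/-! The hitting probability is bounded by a sum of Green functions. To hit `b` from `-x`, the
subordinator must visit some `m` at which the simple walk has displacement `b + x`. By independence
this has probability at most `G(b + x)`, where `G(z) = ∑ m, u(m) P(S(m) = z)` and `u(m)` is the
renewal mass function, with generating function `(1 - z)^(-α/2)`.

Three estimates give `G(z) ≤ C z^(α - 1)`: `u(m) ≤ (m + 1)^(α/2 - 1)` (`stableTail_le_rpow`),
`P(S(m) = z) ≤ 2 / z` (`simpleWalkProb_le_two_div`) and `P(S(m) = z) ≤ 2 (m + 1)^(-1/2)`
(`simpleWalkProb_le_rpow`).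

If `∑ b^(α - 1)` converges over `B`, dominated convergence makes `∑ G(b + x)` less than `1` for
large `x`, so `B` is not massive (`not_isMassive_of_summable`). For Piatetski-Shapiro primes the
series is dominated by a multiple of `∑ n^(β(α - 1))` over all integers `n`, with exponent below
`-1`. No prime counting is needed; primality only excludes `0`. -/

/-! ### The renewal mass function of the subordinator -/

/-- The renewal equation, with `stableTail (2 - α) m = (-1)^m * binom(-α/2, m)` the coefficients
of `(1 - z)^(-α/2)`. -/
theorem sum_stableWeight_mul_stableTail (α : ℝ) (m : ℕ) :
    ∑ ij ∈ Finset.HasAntidiagonal.antidiagonal (m + 1), stableWeight α ij.1 * stableTail (2 - α) ij.2 =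
      stableTail (2 - α) (m + 1) := by
  -- Vandermonde for the exponents `α/2` and `-α/2`: the coefficient form of `(1 - z)^(α/2) (1 -
  -- z)^(-α/2) = 1`.
  have h := Ring.add_choose_eq (m + 1) (Commute.all (α / 2) (-(α / 2)))
  rw [add_neg_cancel, Ring.choose_zero_succ] at h
  have he : (2 - α) / 2 - 1 = -(α / 2) := by ring
  rw [Finset.Nat.sum_antidiagonal_succ] at h ⊢
  simp only [stableWeight, stableTail, he, Nat.succ_ne_zero, if_false, if_true, zero_mul,
    zero_add, Ring.choose_zero_right, one_mul] at h ⊢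
  have hs : ∑ p ∈ Finset.HasAntidiagonal.antidiagonal m, (-1) ^ (p.1 + 1 + 1) * Ring.choose (α / 2) (p.1 + 1) *
      ((-1) ^ p.2 * Ring.choose (-(α / 2)) p.2) =
      (-1) ^ m * ∑ p ∈ Finset.HasAntidiagonal.antidiagonal m,
        Ring.choose (α / 2) (p.1 + 1) * Ring.choose (-(α / 2)) p.2 := by
    rw [Finset.mul_sum]
    refine Finset.sum_congr rfl fun p hp => ?_
    rw [← Finset.HasAntidiagonal.mem_antidiagonal.1 hp]
    ring
  rw [hs]
  linear_combination (-(-1) ^ m) * h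

/-- Each factor `1 - r/(k + 1)` of the product, with `r = α/2`, is at most `((k + 2)/(k + 1))^(-r)`
by Bernoulli, and these bounds telescope. -/
theorem stableTail_le_rpow {α : ℝ} (hα : α ∈ Set.Ioo (0 : ℝ) 2) (k : ℕ) :
    stableTail α k ≤ ((k : ℝ) + 1) ^ (-(α / 2)) := by
  induction k with
  | zero => simp [stableTail]
  | succ k ih =>
    have hk : (0 : ℝ) < k + 1 := by positivity
    have ha := hα.1
    have hb := hα.2
    set r := α / 2 with hr
    have hr0 : 0 < r := by positivity
    have hr1 : r < 1 := by rw [hr]; linarith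
    set x : ℝ := 1 / ((k : ℝ) + 1) with hx
    have hx0 : 0 < x := by positivity
    have hbern : (1 + x) ^ r ≤ 1 + r * x :=
      rpow_one_add_le_one_add_mul_self (by linarith) hr0.le hr1.le
    have hpos : 0 < (1 + x) ^ r := by positivity
    have h1 : 1 - r * x ≤ (1 + x) ^ (-r) := by
      rw [Real.rpow_neg (by positivity), ← one_div, le_div_iff₀ hpos]
      by_cases h : 0 ≤ 1 - r * x
      · nlinarith [mul_le_mul_of_nonneg_left hbern h, sq_nonneg (r * x)]
      · nlinarith
    have h2 : ((k : ℝ) + 1 + 1) = ((k : ℝ) + 1) * (1 + x) := by rw [hx]; field_simp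
    rw [stableTail_succ]
    push_cast
    rw [h2, Real.mul_rpow hk.le (by positivity)]
    have h3 : (1 - r / ((k : ℝ) + 1)) = 1 - r * x := by rw [hx]; ring
    rw [← hr, h3]
    calc stableTail α k * (1 - r * x) ≤ stableTail α k * (1 + x) ^ (-r) :=
          mul_le_mul_of_nonneg_left h1 (stableTail_pos hα k).le
      _ ≤ _ := mul_le_mul_of_nonneg_right ih (by positivity)

/-! ### The simple random walk -/

/-- The probability that the simple random walk on `ℤ` started at `0` is at `z` after `m` steps. -/
noncomputable def simpleWalkProb : ℕ → ℤ → ℝ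
  | 0, z => if z = 0 then 1 else 0
  | m + 1, z => (simpleWalkProb m (z - 1) + simpleWalkProb m (z + 1)) / 2

theorem simpleWalkProb_succ (m : ℕ) (z : ℤ) : simpleWalkProb (m + 1) z =
    (simpleWalkProb m (z - 1) + simpleWalkProb m (z + 1)) / 2 := rfl

theorem simpleWalkProb_nonneg (m : ℕ) (z : ℤ) : 0 ≤ simpleWalkProb m z := by
  induction m generalizing z with
  | zero => rw [simpleWalkProb]; split_ifs <;> norm_num
  | succ m ih => rw [simpleWalkProb_succ]; linarith [ih (z - 1), ih (z + 1)]

theorem simpleWalkProb_neg (m : ℕ) (z : ℤ) : simpleWalkProb m (-z) = simpleWalkProb m z := by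
  induction m generalizing z with
  | zero => simp [simpleWalkProb]
  | succ m ih =>
    rw [simpleWalkProb_succ, simpleWalkProb_succ, ← ih (z - 1), ← ih (z + 1), neg_sub', neg_add',
      sub_neg_eq_add]
    ring

theorem simpleWalkProb_eq_zero_of_odd (m : ℕ) (z : ℤ) (h : Odd (m + z)) :
    simpleWalkProb m z = 0 := by
  induction m generalizing z with
  | zero =>
    rw [simpleWalkProb, if_neg]
    rintro rfl
    simp at h
  | succ m ih =>
    obtain ⟨j, hj⟩ := h
    rw [simpleWalkProb_succ, ih (z - 1), ih (z + 1), add_zero, zero_div]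
    · exact ⟨j, by omega⟩
    · exact ⟨j - 1, by omega⟩

/-- The ratio of consecutive binomial coefficients, cleared of denominators. The recursion is
linear, so induction proves it without a closed formula. Steps of `2` respect parity. -/
theorem simpleWalkProb_ratio (m : ℕ) (z : ℤ) :
    ((m : ℝ) + z + 2) * simpleWalkProb m (z + 2) = (m - z) * simpleWalkProb m z := by
  induction m generalizing z with
  | zero =>
    simp only [simpleWalkProb]
    split_ifs with h1 h2 h2
    · omega
    · have : (z : ℝ) + 2 = 0 := by exact_mod_cast h1
      push_cast; linear_combination this
    · simp [h2]
    · simp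
  | succ m ih =>
    have h1 := ih (z + 1)
    have h2 := ih (z - 1)
    rw [simpleWalkProb_succ, simpleWalkProb_succ]
    rw [show z + 2 - 1 = z + 1 by ring, show z + 2 + 1 = z + 1 + 2 by ring]
    rw [show z - 1 + 2 = z + 1 by ring] at h2
    push_cast at h1 h2 ⊢
    linear_combination (1 / 2) * h1 + (1 / 2) * h2

theorem simpleWalkProb_add_two_le (m : ℕ) (z : ℤ) (hz : -1 ≤ z) :
    simpleWalkProb m (z + 2) ≤ simpleWalkProb m z := by
  have h := simpleWalkProb_ratio m z
  have hz' : (-1 : ℝ) ≤ z := by exact_mod_cast hz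
  have hm : (0 : ℝ) ≤ m := by positivity
  have h0 := simpleWalkProb_nonneg m z
  refine le_of_mul_le_mul_left (a := (m : ℝ) + z + 2) ?_ (by linarith)
  rw [h]
  exact mul_le_mul_of_nonneg_right (by linarith) h0

theorem simpleWalkProb_add_two_mul_le (m : ℕ) (z : ℤ) (hz : -1 ≤ z) (k : ℕ) :
    simpleWalkProb m (z + 2 * k) ≤ simpleWalkProb m z := by
  induction k with
  | zero => simp
  | succ k ih =>
    refine le_trans ?_ ih
    have := simpleWalkProb_add_two_le m (z + 2 * k) (by omega)
    rwa [show z + 2 * ((k + 1 : ℕ) : ℤ) = z + 2 * k + 2 by push_cast; ring]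

theorem sum_simpleWalkProb_le_one (m : ℕ) (s : Finset ℤ) : ∑ z ∈ s, simpleWalkProb m z ≤ 1 := by
  induction m generalizing s with
  | zero =>
    simp only [simpleWalkProb, Finset.sum_ite_eq']
    split_ifs <;> norm_num
  | succ m ih =>
    have h1 := ih (s.map (Equiv.subRight (1 : ℤ)).toEmbedding)
    have h2 := ih (s.map (Equiv.addRight (1 : ℤ)).toEmbedding)
    simp only [Finset.sum_map, Equiv.coe_toEmbedding, Equiv.subRight_apply,
      Equiv.coe_addRight] at h1 h2
    simp only [simpleWalkProb_succ]
    rw [← Finset.sum_div, Finset.sum_add_distrib]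
    linarith

/-- The `z / 2 + 1` sites `z, z - 2, …` down to `0` or `1` each carry at least the mass of `z`, and
the total mass is at most `1`. -/
theorem simpleWalkProb_le_two_div (m z : ℕ) (hz : 0 < z) : simpleWalkProb m z ≤ 2 / z := by
  have hinj : Function.Injective fun j : ℕ => (z : ℤ) - 2 * j := fun i j h => by
    simp only at h; omega
  have h1 := sum_simpleWalkProb_le_one m ((Finset.range (z / 2 + 1)).map ⟨_, hinj⟩)
  rw [Finset.sum_map] at h1
  simp only [Function.Embedding.coeFn_mk] at h1
  have h2 : ((z / 2 + 1 : ℕ) : ℝ) * simpleWalkProb m z ≤ 1 := by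
    refine le_trans ?_ h1
    rw [← nsmul_eq_mul, ← Finset.card_range (z / 2 + 1), Finset.card_range]
    refine (Finset.card_nsmul_le_sum _ _ (simpleWalkProb m z) fun j hj => ?_).trans' (by simp)
    have hj' := Finset.mem_range.1 hj
    have := simpleWalkProb_add_two_mul_le m ((z : ℤ) - 2 * j) (by omega) j
    simpa using this
  have h3 : (z : ℝ) ≤ 2 * ((z / 2 + 1 : ℕ) : ℝ) := by
    norm_cast; omega
  have hz' : (0 : ℝ) < z := by exact_mod_cast hz
  rw [le_div_iff₀ hz']
  nlinarith [simpleWalkProb_nonneg m z]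

/-- The return probability gains the factor `(2n + 1)/(2n + 2)` at each stage, and `(2n + 1)(2n + 3)
≤ (2n + 2)^2`. -/
theorem simpleWalkProb_two_mul_zero_sq_le (n : ℕ) :
    simpleWalkProb (2 * n) 0 ^ 2 * (2 * n + 1) ≤ 1 := by
  induction n with
  | zero => simp [simpleWalkProb]
  | succ n ih =>
    have h1 : simpleWalkProb (2 * (n + 1)) 0 = simpleWalkProb (2 * n + 1) 1 := by
      have := simpleWalkProb_neg (2 * n + 1) 1
      rw [show 2 * (n + 1) = 2 * n + 1 + 1 by ring, simpleWalkProb_succ]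
      simp only [zero_sub, zero_add, this]
      ring
    have h2 := simpleWalkProb_ratio (2 * n) 0
    simp only [zero_add, Int.cast_zero, add_zero, sub_zero] at h2
    have h3 : simpleWalkProb (2 * n + 1) 1 =
        (simpleWalkProb (2 * n) 0 + simpleWalkProb (2 * n) 2) / 2 := by
      rw [simpleWalkProb_succ]; norm_num
    push_cast at h2
    set a := simpleWalkProb (2 * n) 0
    set b := simpleWalkProb (2 * n) 2
    have hn : (0 : ℝ) < 2 * n + 2 := by positivity
    have h4 : (a + b) / 2 = a * ((2 * n + 1) / (2 * n + 2)) := by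
      field_simp; linear_combination h2 / 2
    rw [h1, h3, h4]
    push_cast
    have h5 : ((2 * n + 1) / (2 * n + 2) : ℝ) ^ 2 * (2 * (n + 1) + 1) ≤ 2 * n + 1 := by
      rw [div_pow, div_mul_eq_mul_div, div_le_iff₀ (by positivity)]
      nlinarith [(Nat.cast_nonneg n : (0 : ℝ) ≤ n)]
    calc _ = a ^ 2 * (((2 * n + 1) / (2 * n + 2) : ℝ) ^ 2 * (2 * (n + 1) + 1)) := by ring
      _ ≤ a ^ 2 * (2 * n + 1) := mul_le_mul_of_nonneg_left h5 (sq_nonneg a)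
      _ ≤ 1 := ih

theorem simpleWalkProb_two_mul_le (n : ℕ) (z : ℤ) :
    simpleWalkProb (2 * n) z ≤ simpleWalkProb (2 * n) 0 := by
  wlog hz : 0 ≤ z generalizing z
  · rw [← simpleWalkProb_neg]
    exact this (-z) (by omega)
  obtain ⟨k, rfl⟩ := Int.eq_ofNat_of_zero_le hz
  rcases Nat.even_or_odd' k with ⟨j, rfl | rfl⟩
  · simpa using simpleWalkProb_add_two_mul_le (2 * n) 0 (by norm_num) j
  · rw [simpleWalkProb_eq_zero_of_odd]
    · exact simpleWalkProb_nonneg _ _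
    · exact ⟨n + j, by push_cast; ring⟩

theorem simpleWalkProb_sq_mul_le (m : ℕ) (z : ℤ) : simpleWalkProb m z ^ 2 * (m + 1) ≤ 4 := by
  obtain ⟨n, hn⟩ := Nat.even_or_odd' m
  have h0 := simpleWalkProb_two_mul_zero_sq_le n
  have h1 : simpleWalkProb m z ≤ simpleWalkProb (2 * n) 0 := by
    rcases hn with rfl | rfl
    · exact simpleWalkProb_two_mul_le n z
    -- At odd times the mass is the average of two even-time masses.
    · rw [simpleWalkProb_succ]
      linarith [simpleWalkProb_two_mul_le n (z - 1), simpleWalkProb_two_mul_le n (z + 1)]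
  have h2 : (m : ℝ) + 1 ≤ 4 * (2 * n + 1) := by
    have : m + 1 ≤ 4 * (2 * n + 1) := by omega
    exact_mod_cast this
  have h3 := pow_le_pow_left₀ (simpleWalkProb_nonneg m z) h1 2
  calc _ ≤ simpleWalkProb (2 * n) 0 ^ 2 * (4 * (2 * n + 1)) := by gcongr
    _ ≤ 4 := by linarith

theorem simpleWalkProb_le_rpow (m : ℕ) (z : ℤ) :
    simpleWalkProb m z ≤ 2 * ((m : ℝ) + 1) ^ (-(1 / 2) : ℝ) := by
  have hm : (0 : ℝ) < m + 1 := by positivity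
  refine (pow_le_pow_iff_left₀ (simpleWalkProb_nonneg m z) (by positivity) two_ne_zero).1 ?_
  have : ((((m : ℝ) + 1) ^ (-(1 / 2) : ℝ)) ^ 2) = ((m : ℝ) + 1)⁻¹ := by
    rw [← Real.rpow_natCast, ← Real.rpow_mul hm.le]
    norm_num [Real.rpow_neg_one]
  rw [mul_pow, this, ← div_eq_mul_inv, le_div_iff₀ hm]
  linarith [simpleWalkProb_sq_mul_le m z]

/-! ### The Green function -/

theorem sum_range_rpow_sub_one_le {a : ℝ} (ha : 0 < a) (ha1 : a ≤ 1) (n : ℕ) :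
    ∑ m ∈ Finset.range n, ((m : ℝ) + 1) ^ (a - 1) ≤ (n : ℝ) ^ a / a := by
  induction n with
  | zero => simp [Real.zero_rpow ha.ne']
  | succ n ih =>
    rw [Finset.sum_range_succ]
    refine (add_le_add_left ih _).trans ?_
    have hn : (0 : ℝ) < n + 1 := by positivity
    have h1 : (1 + -(1 / ((n : ℝ) + 1))) ^ a ≤ 1 + a * -(1 / ((n : ℝ) + 1)) := by
      refine rpow_one_add_le_one_add_mul_self ?_ ha.le ha1
      rw [neg_le_neg_iff, div_le_one hn]
      linarith [(Nat.cast_nonneg n : (0 : ℝ) ≤ n)]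
    have h2 : (n : ℝ) = ((n : ℝ) + 1) * (1 + -(1 / ((n : ℝ) + 1))) := by field_simp; ring
    have h3 : (0 : ℝ) ≤ 1 + -(1 / ((n : ℝ) + 1)) := by
      rw [← sub_eq_add_neg, sub_nonneg, div_le_one hn]
      linarith [(Nat.cast_nonneg n : (0 : ℝ) ≤ n)]
    have h4 : (n : ℝ) ^ a = ((n : ℝ) + 1) ^ a * (1 + -(1 / ((n : ℝ) + 1))) ^ a := by
      rw [← Real.mul_rpow hn.le h3, ← h2]
    have h5 : ((n : ℝ) + 1) ^ (a - 1) = ((n : ℝ) + 1) ^ a * (1 / ((n : ℝ) + 1)) := by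
      rw [Real.rpow_sub hn, Real.rpow_one]; ring
    push_cast
    rw [div_add' _ _ _ ha.ne', div_le_div_iff_of_pos_right ha, h4, h5]
    have := mul_le_mul_of_nonneg_left h1 (Real.rpow_nonneg hn.le a)
    linarith

/-- A discrete form of `s ∫ t^(-s-1) dt = -t^(-s)`, which makes the tail sum in `sum_Ico_rpow_le`
telescope. It follows from `log y ≥ 1 - 1/y` and `exp t ≥ 1 + t`. -/
theorem mul_rpow_neg_sub_one_le {s x : ℝ} (hs : 0 < s) (hx : 0 < x) :
    s * (x + 1) ^ (-s - 1) ≤ x ^ (-s) - (x + 1) ^ (-s) := by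
  have hx1 : 0 < x + 1 := by positivity
  have h1 : x ^ (-s) = (x + 1) ^ (-s) * ((x + 1) / x) ^ s := by
    rw [Real.div_rpow hx1.le hx.le, Real.rpow_neg hx.le, Real.rpow_neg hx1.le]
    field_simp
  have h2 : 1 + s * (1 / (x + 1)) ≤ ((x + 1) / x) ^ s := by
    rw [Real.rpow_def_of_pos (by positivity)]
    have h3 := Real.one_sub_inv_le_log_of_pos (show 0 < (x + 1) / x by positivity)
    have h4 : 1 - ((x + 1) / x)⁻¹ = 1 / (x + 1) := by field_simp; ring
    rw [h4] at h3
    have h5 := Real.add_one_le_exp (Real.log ((x + 1) / x) * s)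
    nlinarith
  rw [Real.rpow_sub hx1, Real.rpow_one, h1]
  have := mul_le_mul_of_nonneg_left h2 (Real.rpow_nonneg hx1.le (-s))
  calc _ = (x + 1) ^ (-s) * (1 + s * (1 / (x + 1))) - (x + 1) ^ (-s) := by ring
    _ ≤ _ := by linarith

theorem sum_Ico_rpow_le {s : ℝ} (hs : 0 < s) {N : ℕ} (hN : 0 < N) (n : ℕ) :
    ∑ m ∈ Finset.Ico N n, ((m : ℝ) + 1) ^ (-s - 1) ≤ (N : ℝ) ^ (-s) / s := by
  rcases le_total n N with h | h
  · rw [Finset.Ico_eq_empty_of_le h]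
    simp only [Finset.sum_empty]
    positivity
  · suffices ∑ m ∈ Finset.Ico N n, ((m : ℝ) + 1) ^ (-s - 1) ≤
        ((N : ℝ) ^ (-s) - (n : ℝ) ^ (-s)) / s by
      refine this.trans ?_
      gcongr
      linarith [Real.rpow_nonneg (Nat.cast_nonneg n : (0 : ℝ) ≤ n) (-s)]
    induction n, h using Nat.le_induction with
    | base => simp
    | succ n h ih =>
      rw [Finset.sum_Ico_succ_top h]
      have hn : (0 : ℝ) < n := by exact_mod_cast hN.trans_le h
      have := mul_rpow_neg_sub_one_le hs hn
      rw [le_div_iff₀ hs] at ih ⊢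
      push_cast
      linarith

/-- A constant `C` such that the Green function of the `α`-stable walk is at most
`C * |z| ^ (α - 1)`. -/
noncomputable def greenConst (α : ℝ) : ℝ := 4 / α + 2 / (1 / 2 - α / 2)

/-- The sum is cut at the diffusive time `z ^ 2`: the bound `2 / z` is used before it, the bound `2
(m + 1)^(-1/2)` after it. Both pieces have order `z^(α - 1)`; the second converges because `α < 1`.
-/
theorem sum_stableTail_mul_simpleWalkProb_le {α : ℝ} (hα : α ∈ Set.Ioo (0 : ℝ) 1) {z : ℕ}
    (hz : 0 < z) (n : ℕ) :
    ∑ m ∈ Finset.range n, stableTail (2 - α) m * simpleWalkProb m z ≤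
      greenConst α * (z : ℝ) ^ (α - 1) := by
  have h0 := hα.1
  have h1 := hα.2
  have hα' : 2 - α ∈ Set.Ioo (0 : ℝ) 2 := ⟨by linarith, by linarith⟩
  have hz' : (0 : ℝ) < z := by exact_mod_cast hz
  have he : -((2 - α) / 2) = α / 2 - 1 := by ring
  have hnn : ∀ m, 0 ≤ stableTail (2 - α) m * simpleWalkProb m z := fun m =>
    mul_nonneg (stableTail_pos hα' m).le (simpleWalkProb_nonneg m z)
  have hA : ∑ m ∈ Finset.range (z ^ 2), stableTail (2 - α) m * simpleWalkProb m z ≤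
      4 / α * (z : ℝ) ^ (α - 1) := by
    calc _ ≤ ∑ m ∈ Finset.range (z ^ 2), ((m : ℝ) + 1) ^ (α / 2 - 1) * (2 / z) := by
          refine Finset.sum_le_sum fun m _ => mul_le_mul ?_ (simpleWalkProb_le_two_div m z hz)
            (simpleWalkProb_nonneg m z) (by positivity)
          have := stableTail_le_rpow hα' m
          rwa [he] at this
      _ ≤ (((z ^ 2 : ℕ) : ℝ) ^ (α / 2) / (α / 2)) * (2 / z) := by
          rw [← Finset.sum_mul]
          exact mul_le_mul_of_nonneg_right
            (sum_range_rpow_sub_one_le (by linarith) (by linarith) _) (by positivity)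
      _ = _ := by
          push_cast
          rw [← Real.rpow_natCast, ← Real.rpow_mul hz'.le, Real.rpow_sub hz', Real.rpow_one]
          rw [show ((2 : ℕ) : ℝ) * (α / 2) = α by push_cast; ring]
          field_simp
          ring
  have hB : ∑ m ∈ Finset.Ico (z ^ 2) n, stableTail (2 - α) m * simpleWalkProb m z ≤
      2 / (1 / 2 - α / 2) * (z : ℝ) ^ (α - 1) := by
    have hs : 0 < 1 / 2 - α / 2 := by linarith
    calc _ ≤ ∑ m ∈ Finset.Ico (z ^ 2) n, 2 * ((m : ℝ) + 1) ^ (-(1 / 2 - α / 2) - 1) := by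
          refine Finset.sum_le_sum fun m _ => ?_
          have h2 := stableTail_le_rpow hα' m
          rw [he] at h2
          refine (mul_le_mul h2 (simpleWalkProb_le_rpow m z)
            (simpleWalkProb_nonneg m z) (by positivity)).trans_eq ?_
          rw [mul_left_comm, ← Real.rpow_add (by positivity)]
          ring_nf
      _ ≤ 2 * (((z ^ 2 : ℕ) : ℝ) ^ (-(1 / 2 - α / 2)) / (1 / 2 - α / 2)) := by
          rw [← Finset.mul_sum]
          exact mul_le_mul_of_nonneg_left (sum_Ico_rpow_le hs (by positivity) _) two_pos.le
      _ = _ := by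
          push_cast
          rw [← Real.rpow_natCast, ← Real.rpow_mul hz'.le]
          rw [show ((2 : ℕ) : ℝ) * (-(1 / 2 - α / 2)) = α - 1 by push_cast; ring]
          ring
  calc _ ≤ ∑ m ∈ Finset.range (z ^ 2) ∪ Finset.Ico (z ^ 2) n,
        stableTail (2 - α) m * simpleWalkProb m z := by
        refine Finset.sum_le_sum_of_subset_of_nonneg (fun m hm => ?_) fun m _ _ => hnn m
        simp only [Finset.mem_union, Finset.mem_range, Finset.mem_Ico] at hm ⊢
        omega
    _ = _ := by
        refine Finset.sum_union (Finset.disjoint_left.2 fun m hm => ?_)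
        simp only [Finset.mem_range, Finset.mem_Ico] at hm ⊢
        omega
    _ ≤ _ := by rw [greenConst, add_mul]; exact add_le_add hA hB

theorem tsum_stableTail_mul_simpleWalkProb_le {α : ℝ} (hα : α ∈ Set.Ioo (0 : ℝ) 1) {z : ℕ}
    (hz : 0 < z) :
    ∑' m, ENNReal.ofReal (stableTail (2 - α) m) * ENNReal.ofReal (simpleWalkProb m z) ≤
      ENNReal.ofReal (greenConst α * (z : ℝ) ^ (α - 1)) := by
  have hα' : 2 - α ∈ Set.Ioo (0 : ℝ) 2 := ⟨by linarith [hα.2], by linarith [hα.1]⟩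
  refine ENNReal.tsum_le_of_sum_range_le fun n => ?_
  simp only [← ENNReal.ofReal_mul (stableTail_pos hα' _).le]
  rw [← ENNReal.ofReal_sum_of_nonneg fun m _ =>
    mul_nonneg (stableTail_pos hα' m).le (simpleWalkProb_nonneg m z)]
  exact ENNReal.ofReal_le_ofReal (sum_stableTail_mul_simpleWalkProb_le hα hz n)

/-! ### Laws of sums of independent increments -/

/-- Decomposition by the value of the last increment, which is independent of the preceding partial
sum. It serves both the simple walk and the subordinator. -/
theorem infinitePi_sum_range_succ_eq_tsum {M : Type*} [AddCommMonoid M] [Countable M]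
    [MeasurableSpace M] [MeasurableSingletonClass M] [MeasurableAdd₂ M] (p : PMF M) (n : ℕ)
    (m : M) :
    MeasureTheory.Measure.infinitePi (fun _ : ℕ => p.toMeasure)
        {ω | ∑ i ∈ Finset.range (n + 1), ω i = m} =
      ∑' k, p k * MeasureTheory.Measure.infinitePi (fun _ : ℕ => p.toMeasure)
        {ω | ∑ i ∈ Finset.range n, ω i + k = m} := by
  set μ := MeasureTheory.Measure.infinitePi (fun _ : ℕ => p.toMeasure) with hμ
  have hind := (ProbabilityTheory.iIndepFun_infinitePi (P := fun _ : ℕ => p.toMeasure)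
    (X := fun _ => id) fun _ => measurable_id).indepFun_finsetSum_of_notMem
    (fun i => measurable_pi_apply i) (Finset.notMem_range_self (n := n))
  have hset : {ω : ℕ → M | ∑ i ∈ Finset.range (n + 1), ω i = m} =
      ⋃ k, {ω | ∑ i ∈ Finset.range n, ω i + k = m} ∩ {ω | ω n = k} := by
    ext ω
    simp [Finset.sum_range_succ]
  have hms : ∀ k, MeasurableSet {x : M | x + k = m} := fun k => Set.to_countable _ |>.measurableSet
  have hS : Measurable fun ω : ℕ → M => ∑ i ∈ Finset.range n, ω i :=
    Finset.measurable_sum _ fun i _ => measurable_pi_apply i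
  have hm1 : ∀ k, MeasurableSet {ω : ℕ → M | ∑ i ∈ Finset.range n, ω i + k = m} := fun k =>
    measurableSet_eq_fun (hS.add_const k) measurable_const
  have hm2 : ∀ k, MeasurableSet {ω : ℕ → M | ω n = k} := fun k =>
    measurableSet_eq_fun (measurable_pi_apply n) measurable_const
  rw [hset, MeasureTheory.measure_iUnion]
  · refine tsum_congr fun k => ?_
    have h := hind.measure_inter_preimage_eq_mul {x | x + k = m} {k} (hms k)
      (measurableSet_singleton k)
    have he : μ {ω | ω n = k} = p k := by
      have := (measurePreserving_eval_infinitePi (fun _ : ℕ => p.toMeasure)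
        n).measure_preimage (measurableSet_singleton k).nullMeasurableSet
      rw [PMF.toMeasure_apply_singleton _ _ (measurableSet_singleton k)] at this
      exact this
    rw [mul_comm, ← he]
    have hp : (∑ j ∈ Finset.range n, fun ω : ℕ → M => id (ω j)) ⁻¹' {x | x + k = m} =
        {ω | ∑ i ∈ Finset.range n, ω i + k = m} := by
      ext ω
      simp
    rw [hp] at h
    exact h
  · intro i j hij
    refine Set.disjoint_left.2 fun ω h1 h2 => hij ?_
    exact h1.2.symm.trans h2.2
  · exact fun k => (hm1 k).inter (hm2 k)

theorem simpleStep_apply (k : ℤ) : simpleStep k = if k = -1 ∨ k = 1 then 2⁻¹ else 0 := by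
  simp [simpleStep, PMF.uniformOfFinset_apply]

theorem infinitePi_simpleStep_sum_range (m : ℕ) (z : ℤ) :
    MeasureTheory.Measure.infinitePi (fun _ : ℕ => simpleStep.toMeasure)
      {ω | ∑ i ∈ Finset.range m, ω i = z} = ENNReal.ofReal (simpleWalkProb m z) := by
  induction m generalizing z with
  | zero =>
    by_cases h : z = 0
    · simp [simpleWalkProb, h]
    · simp [simpleWalkProb, h, Ne.symm h]
  | succ m ih =>
    rw [infinitePi_sum_range_succ_eq_tsum, tsum_eq_sum (s := {-1, 1})]
    · rw [Finset.sum_pair (by norm_num), simpleWalkProb_succ]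
      have h1 := ih (z - 1)
      have h2 := ih (z + 1)
      simp only [eq_sub_iff_add_eq] at h1
      simp only [← sub_eq_iff_eq_add, sub_eq_add_neg] at h2
      rw [h1, h2, simpleStep_apply, simpleStep_apply, div_eq_inv_mul, ENNReal.ofReal_mul (by norm_num),
        ENNReal.ofReal_add (simpleWalkProb_nonneg _ _) (simpleWalkProb_nonneg _ _),
        ENNReal.ofReal_inv_of_pos two_pos]
      simp [mul_add, add_comm]
    · intro k hk
      rw [simpleStep_apply, if_neg (by simpa using hk), zero_mul]

theorem subordinatorStep_apply (α : ℝ) (hα : α ∈ Set.Ioo (0 : ℝ) 2) (k : ℕ) :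
    subordinatorStep α hα k = ENNReal.ofReal (stableWeight α k) := rfl

/-- Induction on the number of terms: splitting off one increment turns the bound for `N` into the
one for `N + 1` through the renewal equation. -/
theorem sum_infinitePi_subordinatorStep_le (α : ℝ) (hα : α ∈ Set.Ioo (0 : ℝ) 2) (N m : ℕ) :
    ∑ n ∈ Finset.range N, MeasureTheory.Measure.infinitePi
        (fun _ : ℕ => (subordinatorStep α hα).toMeasure) {ω | ∑ i ∈ Finset.range n, ω i = m} ≤
      ENNReal.ofReal (stableTail (2 - α) m) := by
  have hα' : 2 - α ∈ Set.Ioo (0 : ℝ) 2 := ⟨by linarith [hα.2], by linarith [hα.1]⟩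
  induction N generalizing m with
  | zero => simp
  | succ N ih =>
    rw [Finset.sum_range_succ']
    simp only [infinitePi_sum_range_succ_eq_tsum]
    set μ := MeasureTheory.Measure.infinitePi
      (fun _ : ℕ => (subordinatorStep α hα).toMeasure) with hμ
    have hzero : ∀ n k, k ∉ Finset.range (m + 1) →
        subordinatorStep α hα k * μ {ω | ∑ i ∈ Finset.range n, ω i + k = m} = 0 := by
      intro n k hk
      have : {ω : ℕ → ℕ | ∑ i ∈ Finset.range n, ω i + k = m} = ∅ := by
        ext ω
        simp only [Finset.mem_range, Set.mem_ofPred_eq, Set.mem_empty_iff_false, iff_false] at hk ⊢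
        omega
      rw [this, MeasureTheory.measure_empty, mul_zero]
    rw [Finset.sum_congr rfl fun n _ => tsum_eq_sum (hzero n), Finset.sum_comm]
    cases m with
    | zero => simp [subordinatorStep_apply, stableWeight, stableTail]
    | succ m =>
      -- The `n = 0` term contributes only at the origin.
      have h0 : μ {ω | ∑ i ∈ Finset.range 0, ω i = m + 1} = 0 := by simp
      rw [h0, add_zero, ← sum_stableWeight_mul_stableTail,
        Finset.Nat.sum_antidiagonal_eq_sum_range_succ_mk,
        ENNReal.ofReal_sum_of_nonneg fun k _ =>
          mul_nonneg (stableWeight_nonneg hα k) (stableTail_pos hα' _).le]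
      refine Finset.sum_le_sum fun k hk => ?_
      rw [← Finset.mul_sum, ENNReal.ofReal_mul (stableWeight_nonneg hα k), subordinatorStep_apply]
      refine mul_le_mul_right ?_ _
      refine le_trans (le_of_eq ?_) (ih (m + 1 - k))
      refine Finset.sum_congr rfl fun n _ => congrArg μ ?_
      ext ω
      have := Finset.mem_range.1 hk
      simp only [Set.mem_ofPred_eq]
      omega

theorem infinitePi_subordinatorStep_hits_le (α : ℝ) (hα : α ∈ Set.Ioo (0 : ℝ) 2) (m : ℕ) :
    MeasureTheory.Measure.infinitePi (fun _ : ℕ => (subordinatorStep α hα).toMeasure)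
        {ω | ∃ n : ℕ, ∑ i ∈ Finset.range n, ω i = m} ≤
      ENNReal.ofReal (stableTail (2 - α) m) := by
  rw [Set.ofPred_exists]
  exact (MeasureTheory.measure_iUnion_le _).trans
    (ENNReal.tsum_le_of_sum_range_le fun N => sum_infinitePi_subordinatorStep_le α hα N m)

/-! ### Hitting probabilities -/

/-- Union bound over the target `b` and the value `m` of the subordinator; each event is a rectangle
for the product measure. Starting left of the origin keeps every displacement `b + x` positive. -/
theorem hittingProbability_le_tsum {α : ℝ} (hα : α ∈ Set.Ioo (0 : ℝ) 2) (hα1 : α < 1)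
    (B : Set ℕ) {x : ℕ} (hx : 0 < x) :
    hittingProbability α hα ((fun b : ℕ => (b : ℤ)) '' B) (-(x : ℤ)) ≤
      ∑' b : B, ENNReal.ofReal (greenConst α * (((b : ℕ) + x : ℕ) : ℝ) ^ (α - 1)) := by
  have hsub : {ω | ∃ n : ℕ, stableWalk (-(x : ℤ)) n ω ∈ (fun b : ℕ => (b : ℤ)) '' B} ⊆
      ⋃ b : B, ⋃ m : ℕ, {ω | ∑ i ∈ Finset.range m, ω i = (((b : ℕ) + x : ℕ) : ℤ)} ×ˢ
        {ω | ∃ n : ℕ, ∑ i ∈ Finset.range n, ω i = m} := by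
    rintro ω ⟨n, b, hb, h⟩
    simp only [Set.mem_iUnion]
    refine ⟨⟨b, hb⟩, subordinator n ω, ?_, n, rfl⟩
    simp only [stableWalk, simpleWalk] at h
    simp only [Set.mem_ofPred_eq]
    push_cast
    linarith
  refine (MeasureTheory.measure_mono hsub).trans ((MeasureTheory.measure_iUnion_le _).trans
    (ENNReal.tsum_le_tsum fun b => (MeasureTheory.measure_iUnion_le _).trans ?_))
  refine le_trans (ENNReal.tsum_le_tsum fun m => ?_)
    (tsum_stableTail_mul_simpleWalkProb_le ⟨hα.1, hα1⟩ (z := (b : ℕ) + x) (by omega))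
  rw [walkMeasure, MeasureTheory.Measure.prod_prod, mul_comm, infinitePi_simpleStep_sum_range]
  exact mul_le_mul_left (infinitePi_subordinatorStep_hits_le α hα m) _

theorem not_isMassive_of_summable {α : ℝ} (hα : α ∈ Set.Ioo (0 : ℝ) 2) (hα1 : α < 1)
    {B : Set ℕ} (hB : 0 ∉ B) (hs : Summable fun b : B => ((b : ℕ) : ℝ) ^ (α - 1)) :
    ¬ IsMassive α hα ((fun b : ℕ => (b : ℤ)) '' B) := by
  have hC : 0 ≤ greenConst α := by
    have := hα.1
    have : 0 < 1 / 2 - α / 2 := by linarith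
    rw [greenConst]
    positivity
  -- Zero must be excluded: `0 ^ (α - 1)` is `0` by convention, so the domination below would fail
  -- at `b = 0`.
  have hpos : ∀ b : B, (0 : ℝ) < ((b : ℕ) : ℝ) := fun b =>
    Nat.cast_pos.2 (Nat.pos_of_ne_zero fun h => hB (h ▸ b.2))
  have hle : ∀ (x : ℕ) (b : B), (((b : ℕ) + x : ℕ) : ℝ) ^ (α - 1) ≤ ((b : ℕ) : ℝ) ^ (α - 1) :=
    fun x b => Real.rpow_le_rpow_of_nonpos (hpos b) (by push_cast; linarith [
      (Nat.cast_nonneg x : (0 : ℝ) ≤ x)]) (by linarith)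
  have hlim : Filter.Tendsto (fun x : ℕ => ∑' b : B, (((b : ℕ) + x : ℕ) : ℝ) ^ (α - 1))
      Filter.atTop (nhds (∑' _ : B, (0 : ℝ))) := by
    refine tendsto_tsum_of_dominated_convergence hs (fun b => ?_) (Filter.Eventually.of_forall
      fun x b => ?_)
    · have h1 := tendsto_rpow_neg_atTop (show 0 < 1 - α by linarith)
      rw [neg_sub] at h1
      refine h1.comp (tendsto_natCast_atTop_atTop.comp ?_)
      exact Filter.tendsto_atTop_mono (fun x => Nat.le_add_left x b) Filter.tendsto_id
    · rw [Real.norm_of_nonneg (by positivity)]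
      exact hle x b
  rw [tsum_zero] at hlim
  have hlim' := hlim.const_mul (greenConst α)
  rw [mul_zero] at hlim'
  obtain ⟨x, hx1, hx⟩ := ((hlim'.eventually_lt_const one_pos).and
    (Filter.eventually_gt_atTop 0)).exists
  intro hm
  have h := hittingProbability_le_tsum hα hα1 B hx
  rw [hm, ← ENNReal.ofReal_tsum_of_nonneg (fun b => by positivity)
    ((hs.of_nonneg_of_le (fun b => by positivity) (hle x)).mul_left _), tsum_mul_left,
    ← ENNReal.ofReal_one, ENNReal.ofReal_le_ofReal_iff'] at h
  rcases h with h | h <;> linarith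

/-! ### Piatetski-Shapiro primes -/

theorem summable_rpow_piatetskiShapiroPrimes {α β : ℝ} (hα : α < 1) (hβ : 1 ≤ β)
    (h : α + 1 / β < 1) :
    Summable fun p : piatetskiShapiroPrimes β => ((p : ℕ) : ℝ) ^ (α - 1) := by
  have hβ0 : 0 < β := by linarith
  choose g hg1 hg using fun p : piatetskiShapiroPrimes β => p.2.2
  have hinj : Function.Injective g := fun p q hpq => by
    apply Subtype.ext
    rw [hg p, hg q, hpq]
  have hexp : β * (α - 1) < -1 := by
    have := (div_lt_iff₀ hβ0).1 (show 1 / β < 1 - α by linarith)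
    linarith
  have hs := ((Real.summable_nat_rpow.2 hexp).mul_left ((1 / 2 : ℝ) ^ (α - 1))).comp_injective hinj
  refine hs.of_nonneg_of_le (fun p => by positivity) fun p => ?_
  have hn : (1 : ℝ) ≤ g p := by exact_mod_cast hg1 p
  have h1 : (1 : ℝ) ≤ (g p : ℝ) ^ β := Real.one_le_rpow hn hβ0.le
  -- For `y ≥ 1` the integer part is at least `y / 2`.
  have h2 : 1 / 2 * (g p : ℝ) ^ β ≤ ((p : ℕ) : ℝ) := by
    rw [hg p]
    have h3 := Nat.lt_floor_add_one ((g p : ℝ) ^ β)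
    have h4 : (1 : ℝ) ≤ (⌊(g p : ℝ) ^ β⌋₊ : ℝ) := by
      exact_mod_cast Nat.le_floor (by exact_mod_cast h1)
    linarith
  have hg0 : (0 : ℝ) ≤ g p := by positivity
  simp only [Function.comp_apply]
  rw [Real.rpow_mul hg0, ← Real.mul_rpow (by norm_num) (by positivity)]
  exact Real.rpow_le_rpow_of_nonpos (by linarith) h2 (by linarith)

theorem mainTheorem8 (α : ℝ) (hα : α ∈ Set.Ioo (0 : ℝ) (391 / 2817)) :
    (∃ β ∈ Set.Ico (1 : ℝ) (2817 / 2426), α + 1 / β < 1) ∧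
    ∀ β ∈ Set.Ico (1 : ℝ) (2817 / 2426), α + 1 / β < 1 →
      (Summable fun p : piatetskiShapiroPrimes β => ((p : ℕ) : ℝ) ^ (α - 1)) ∧
      ¬ IsMassive α ⟨hα.1, hα.2.trans (by norm_num)⟩
        ((fun p : ℕ => (p : ℤ)) '' piatetskiShapiroPrimes β) := by
  obtain ⟨h0, h1⟩ := hα
  have hα1 : α < 1 := h1.trans (by norm_num)
  refine ⟨?_, fun β hβ h => ?_⟩
  · obtain ⟨γ, hγ1, hγ2⟩ := exists_between h1
    have hγ : 0 < 1 - γ := by linarith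
    -- With `1 / β = 1 - γ`, the condition on `α` is `α < γ`, and `β < 2817/2426` is `γ < 391/2817`,
    -- since `1 - 391/2817 = 2426/2817`.
    refine ⟨1 / (1 - γ), ⟨?_, ?_⟩, ?_⟩
    · rw [le_div_iff₀ hγ]; linarith
    · rw [div_lt_iff₀ hγ]; linarith
    · rw [one_div_one_div]; linarith
  · have hs := summable_rpow_piatetskiShapiroPrimes hα1 hβ.1 h
    exact ⟨hs, not_isMassive_of_summable _ hα1 (fun h => Nat.not_prime_zero h.1) hs⟩
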